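/- Let $\mathbb K$ be $\mathbb R$ or $\mathbb C$, let $m$ be a natural number, and let $B_1,\dots,B_m$ be Banach spaces over $\mathbb K$. Let $N:[0,\infty)^m\to[0,\infty)$ be a continuous function that is nondecreasing in each variable separately and satisfies $N(ca_1,\dots,ca_m)=c\,N(a_1,\dots,a_m)$ for all $c\ge 0$ and $N(a_1+b_1,\dots,a_m+b_m)\le N(a_1,\dots,a_m)+N(b_1,\dots,b_m)$ for all $a_j,b_j\ge 0$. Suppose moreover that for every sequence $x_n=(x_n^{(1)},\dots,x_n^{(m)})$ in $B_1\times\cdots\times B_m$ one has $N(\|x_n^{(1)}\|,\dots,\|x_n^{(m)}\|)\to 0$ if and only if $\|x_n^{(j)}\|\to 0$ for every $j=1,\dots,m$. Let $B=B_1\times\cdots\times B_m$ carry the norm $$\|x\|=N(\|x^{(1)}\|,\dots,\|x^{(m)}\|),\qquad x=(x^{(1)},\dots,x^{(m)})\in B .$$ A Banach space has the Banach–Saks property if every bounded sequence in it has a subsequence $(y_i)_{i\ge1}$ whose arithmetic means $\frac1n\sum_{i=1}^n y_i$ converge in norm as $n\to\infty$; it has the weak Banach–Saks property if every weakly convergent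 sequence in it has such a subsequence. Then: 1. $B$ is a Banach space. 2. If every $B_j$ ($j=1,\dots,m$) has the Banach–Saks property, then $B$ has the Banach–Saks property. 3. If every $B_j$ ($j=1,\dots,m$) has the weak Banach–Saks property, then $B$ has the weak Banach–Saks property. -/

import Mathlib

open Filter Topology
open scoped NNReal

/-- The arithmetic means of the first `n` terms of `y` converge in norm to some point of `E`. -/
def CesaroConverges (𝕜 : Type*) [RCLike 𝕜] {E : Type*} [NormedAddCommGroup E] [NormedSpace 𝕜 E]
    (y : ℕ → E) : Prop :=
  ∃ z : E, Tendsto (fun n : ℕ => (n : 𝕜)⁻¹ • ∑ i ∈ Finset.range n, y i) atTop (𝓝 z)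

/-- The Banach-Saks property: every bounded sequence has a subsequence whose arithmetic means
converge in norm. -/
def BanachSaksProperty (𝕜 : Type*) [RCLike 𝕜] (E : Type*) [NormedAddCommGroup E]
    [NormedSpace 𝕜 E] : Prop :=
  ∀ x : ℕ → E, Bornology.IsBounded (Set.range x) →
    ∃ φ : ℕ → ℕ, StrictMono φ ∧ CesaroConverges 𝕜 (x ∘ φ)

/-- The weak Banach-Saks property: every weakly convergent sequence has a subsequence whose
arithmetic means converge in norm. -/
def WeakBanachSaksProperty (𝕜 : Type*) [RCLike 𝕜] (E : Type*) [NormedAddCommGroup E]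
    [NormedSpace 𝕜 E] : Prop :=
  ∀ (x : ℕ → E) (l : E),
    Tendsto (fun n => toWeakSpace 𝕜 E (x n)) atTop (𝓝 (toWeakSpace 𝕜 E l)) →
    ∃ φ : ℕ → ℕ, StrictMono φ ∧ CesaroConverges 𝕜 (x ∘ φ)

/-- The conditions on a nonnegative function `N` of `m` nonnegative variables under which
`x ↦ N (‖x 1‖, …, ‖x m‖)` is used as the norm of the product of the spaces `B j`. -/
structure IsProductNormFunction {m : ℕ} (B : Fin m → Type*) [∀ j, NormedAddCommGroup (B j)]
    (N : (Fin m → ℝ≥0) → ℝ≥0) : Prop where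
  continuous : Continuous N
  /-- `N` is (weakly) increasing in each variable separately. -/
  increasing : ∀ (a : Fin m → ℝ≥0) (j : Fin m), Monotone fun t : ℝ≥0 => N (Function.update a j t)
  homogeneous : ∀ (c : ℝ≥0) (a : Fin m → ℝ≥0), N (c • a) = c * N a
  subadditive : ∀ a b : Fin m → ℝ≥0, N (a + b) ≤ N a + N b
  /-- `‖x‖ → 0` if and only if `‖x j‖ → 0` for every `j`. -/
  tendsto_zero_iff : ∀ x : ℕ → ∀ j, B j,
    Tendsto (fun n => N fun j => ‖x n j‖₊) atTop (𝓝 0) ↔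
      ∀ j, Tendsto (fun n => ‖x n j‖) atTop (𝓝 0)

namespace IsProductNormFunction

variable {m : ℕ} {B : Fin m → Type*} [∀ j, NormedAddCommGroup (B j)] {N : (Fin m → ℝ≥0) → ℝ≥0}

theorem monotone (hN : IsProductNormFunction B N) : Monotone N := by
  intro a b hab
  have key : ∀ s : Finset (Fin m), N a ≤ N (s.piecewise b a) := by
    intro s
    induction s using Finset.induction_on with
    | empty => simp
    | insert j s hj ih =>
      refine ih.trans ?_
      rw [Finset.piecewise_insert]
      have h := hN.increasing (s.piecewise b a) j (hab j)
      have h2 : Function.update (s.piecewise b a) j (a j) = s.piecewise b a := by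
        rw [Function.update_eq_iff]; simp [hj]
      simpa [h2] using h
  simpa using key Finset.univ

theorem eq_zero (hN : IsProductNormFunction B N) (x : ∀ j, B j)
    (hx : N (fun j => ‖x j‖₊) = 0) : x = 0 := by
  have h := (hN.tendsto_zero_iff fun _ => x).1 (by simp [hx])
  funext j
  simpa using tendsto_nhds_unique tendsto_const_nhds (h j)

end IsProductNormFunction

/-- The product `B 1 × ⋯ × B m`, as a vector space the usual product, with the norm
`‖x‖ = N (‖x 1‖, …, ‖x m‖)`. -/
def ProductSpace {m : ℕ} {B : Fin m → Type*} [∀ j, NormedAddCommGroup (B j)]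
    {N : (Fin m → ℝ≥0) → ℝ≥0} (_hN : IsProductNormFunction B N) : Type _ :=
  ∀ j, B j

namespace ProductSpace

variable {m : ℕ} {B : Fin m → Type*} [∀ j, NormedAddCommGroup (B j)]
  {N : (Fin m → ℝ≥0) → ℝ≥0} (hN : IsProductNormFunction B N)

/-- The norm of the product space. -/
noncomputable def productNorm : AddGroupNorm (∀ j, B j) where
  toFun x := N fun j => ‖x j‖₊
  map_zero' := by
    have h := hN.homogeneous 0 0
    simpa [Pi.zero_def] using h
  add_le' x y := by
    have h : N (fun j => ‖x j + y j‖₊) ≤ N (fun j => ‖x j‖₊) + N (fun j => ‖y j‖₊) :=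
      (hN.monotone fun j => nnnorm_add_le (x j) (y j)).trans (hN.subadditive _ _)
    exact_mod_cast h
  neg' x := by simp
  eq_zero_of_map_eq_zero' x hx := hN.eq_zero x (by exact_mod_cast hx)

noncomputable instance : NormedAddCommGroup (ProductSpace hN) :=
  (productNorm hN).toNormedAddCommGroup

variable {hN} in
theorem norm_def (x : ProductSpace hN) : ‖x‖ = N fun j => ‖x j‖₊ := rfl

instance (𝕜 : Type*) [RCLike 𝕜] [∀ j, NormedSpace 𝕜 (B j)] : Module 𝕜 (ProductSpace hN) :=
  inferInstanceAs (Module 𝕜 (∀ j, B j))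

noncomputable instance (𝕜 : Type*) [RCLike 𝕜] [∀ j, NormedSpace 𝕜 (B j)] :
    NormedSpace 𝕜 (ProductSpace hN) where
  norm_smul_le c x := by
    have h : N (fun j => ‖c • x j‖₊) = ‖c‖₊ * N (fun j => ‖x j‖₊) := by
      rw [← hN.homogeneous]
      congr 1
      funext j
      simp [nnnorm_smul]
    have h' : ‖c • x‖ = ‖c‖ * ‖x‖ := by
      rw [norm_def, norm_def, ← coe_nnnorm c, ← NNReal.coe_mul, ← h]
      rfl
    exact h'.le

end ProductSpace

/-! The norm given by `N` has the same null sequences as the product topology, so it induces that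
topology; completeness and convergence of means can be checked coordinatewise. The difficulty is to
find one subsequence that serves all coordinates, because convergence of arithmetic means need not
pass to subsequences. The Erdős–Magidor argument, `exists_subseq_forall_subseq_cesaroConverges`,
supplies subsequences for which it does, so refining one coordinate after another loses nothing.

For this, colour a 2k-element set of indices by whether the averages of `x` over its lower and upper
halves differ by at most ε. Ramsey's theorem makes tails homogeneous, and a single subsequence with
convergent means rules out the bad colour for some k (`exists_infinite_hasCloseBlocks`).
Diagonalizing over ε = 1/(p+1) gives a set where, for each ε, successive blocks of a suitable length
have nearly equal averages far out. This property is inherited by subsequences and makes the means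
Cauchy (`cesaroConverges_of_close_blocks`). -/

/-! ### Infinite Ramsey theory on the naturals -/

/-- Fusion: if every infinite set has, for each `n`, an infinite subset with the hereditary property
`R n`, then it has an infinite subset whose tail beyond each of its elements `a` satisfies `R a`. -/
theorem exists_infinite_fusion {R : ℕ → Set ℕ → Prop}
    (hered : ∀ n S T, T ⊆ S → R n S → R n T)
    (dense : ∀ n (S : Set ℕ), S.Infinite → ∃ T ⊆ S, T.Infinite ∧ R n T)
    {S : Set ℕ} (hS : S.Infinite) :
    ∃ T ⊆ S, T.Infinite ∧ ∀ a ∈ T, R a (T ∩ Set.Ioi a) := by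
  have step : ∀ U : {U : Set ℕ // U.Infinite}, ∃ a ∈ U.1, ∃ V : {V : Set ℕ // V.Infinite},
      V.1 ⊆ U.1 ∩ Set.Ioi a ∧ R a V.1 := by
    rintro ⟨U, hU⟩
    obtain ⟨a, ha⟩ := hU.nonempty
    have hinf : (U ∩ Set.Ioi a).Infinite := by
      have : (U \ Set.Iic a).Infinite := hU.sdiff (Set.finite_Iic a)
      refine this.mono fun x hx => ⟨hx.1, ?_⟩
      simpa using hx.2
    obtain ⟨V, hVU, hV, hR⟩ := dense a _ hinf
    exact ⟨a, ha, ⟨V, hV⟩, hVU, hR⟩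
  choose a ha next hnext hR using step
  let s : ℕ → {U : Set ℕ // U.Infinite} := fun n => next^[n] ⟨S, hS⟩
  have s_succ : ∀ n, s (n + 1) = next (s n) := fun n => Function.iterate_succ_apply' _ _ _
  have s_anti : Antitone fun n => (s n).1 := by
    refine antitone_nat_of_succ_le fun n => ?_
    rw [s_succ]
    exact (hnext _).trans Set.inter_subset_left
  have a_mono : StrictMono fun n => a (s n) := by
    refine strictMono_nat_of_lt_succ fun n => ?_
    have h := ha (s (n + 1))
    have h' : a (s (n + 1)) ∈ (next (s n)).1 := by rwa [← s_succ]
    exact (hnext _ h').2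
  refine ⟨Set.range fun n => a (s n), ?_, Set.infinite_range_of_injective a_mono.injective, ?_⟩
  · rintro _ ⟨n, rfl⟩
    exact s_anti (Nat.zero_le n) (ha (s n))
  · rintro _ ⟨n, rfl⟩
    -- All later chosen points lie in `s (n + 1)`, which was chosen to satisfy `R (a (s n))`.
    refine hered _ _ _ ?_ (hR (s n))
    rintro _ ⟨⟨l, rfl⟩, hl⟩
    have hnl : n + 1 ≤ l := a_mono.lt_iff_lt.1 hl
    rw [← s_succ]
    exact s_anti hnl (ha (s l))

/-- A sequence of hereditary dense properties of infinite sets of naturals can be diagonalized. -/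
theorem exists_infinite_diagonal {Q : ℕ → Set ℕ → Prop}
    (hered : ∀ n S T, T ⊆ S → Q n S → Q n T)
    (dense : ∀ n (S : Set ℕ), S.Infinite → ∃ T ⊆ S, T.Infinite ∧ Q n T)
    {S : Set ℕ} (hS : S.Infinite) :
    ∃ T ⊆ S, T.Infinite ∧ ∀ a ∈ T, ∀ n ≤ a, Q n (T ∩ Set.Ioi a) := by
  refine exists_infinite_fusion (R := fun a T => ∀ n ≤ a, Q n T)
    (fun a S T hTS h n hn => hered n S T hTS (h n hn)) (fun a => ?_) hS
  -- Only finitely many properties are needed at each `a`: shrink once for each, heredity keeping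
  -- the earlier ones.
  induction a with
  | zero =>
    intro U hU
    obtain ⟨T, hTU, hT, hQ⟩ := dense 0 U hU
    refine ⟨T, hTU, hT, fun n hn => ?_⟩
    rwa [Nat.le_zero.1 hn]
  | succ a ih =>
    intro U hU
    obtain ⟨T, hTU, hT, hQ⟩ := ih U hU
    obtain ⟨V, hVT, hV, hQ'⟩ := dense (a + 1) T hT
    refine ⟨V, hVT.trans hTU, hV, fun n hn => ?_⟩
    rcases Nat.le_succ_iff.1 hn with h | rfl
    · exact hered n _ _ hVT (hQ n h)
    · exact hQ'

/-- All `k`-element subsets of `T` satisfy `P`, or none does. -/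
def IsHomogeneous (P : Finset ℕ → Prop) (k : ℕ) (T : Set ℕ) : Prop :=
  (∀ F : Finset ℕ, ↑F ⊆ T → F.card = k → P F) ∨ ∀ F : Finset ℕ, ↑F ⊆ T → F.card = k → ¬P F

theorem IsHomogeneous.mono {P : Finset ℕ → Prop} {k : ℕ} {S T : Set ℕ} (hTS : T ⊆ S)
    (h : IsHomogeneous P k S) : IsHomogeneous P k T :=
  h.imp (fun h F hF => h F (hF.trans hTS)) (fun h F hF => h F (hF.trans hTS))

/-- The infinite Ramsey theorem for two-colorings of `k`-element sets of naturals. -/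
theorem exists_infinite_isHomogeneous (k : ℕ) : ∀ (P : Finset ℕ → Prop) {S : Set ℕ}, S.Infinite →
    ∃ T ⊆ S, T.Infinite ∧ IsHomogeneous P k T := by
  induction k with
  | zero =>
    intro P S hS
    refine ⟨S, subset_rfl, hS, ?_⟩
    by_cases h : P ∅
    · exact .inl fun F _ hF => by rwa [Finset.card_eq_zero.1 hF]
    · exact .inr fun F _ hF => by rwa [Finset.card_eq_zero.1 hF]
  | succ k ih =>
    intro P S hS
    -- After fusion, the colour of a (k+1)-set in `T` depends only on its least element; the
    -- pigeonhole principle on least elements then finishes.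
    obtain ⟨T, hTS, hT, hom⟩ := exists_infinite_fusion
      (R := fun a T => IsHomogeneous (fun F => P (insert a F)) k T)
      (fun n S T hTS h => h.mono hTS) (fun n S hS => ih _ hS) hS
    have split : ∀ F : Finset ℕ, ∀ U ⊆ T, ↑F ⊆ U → F.card = k + 1 → ∃ a ∈ U, ∃ G : Finset ℕ,
        ↑G ⊆ T ∩ Set.Ioi a ∧ G.card = k ∧ F = insert a G := by
      intro F U hUT hF hcard
      have hne : F.Nonempty := Finset.card_pos.1 (by omega)
      refine ⟨F.min' hne, hF (F.min'_mem hne), F.erase (F.min' hne), fun x hx => ?_, ?_, ?_⟩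
      · have hx' : x ∈ F.erase (F.min' hne) := hx
        exact ⟨hUT (hF (Finset.mem_of_mem_erase hx')), F.min'_lt_of_mem_erase_min' hne hx'⟩
      · rw [Finset.card_erase_of_mem (F.min'_mem hne), hcard, Nat.add_sub_cancel]
      · rw [Finset.insert_erase (F.min'_mem hne)]
    let T₁ : Set ℕ := {a ∈ T | ∀ F : Finset ℕ, ↑F ⊆ T ∩ Set.Ioi a → F.card = k → P (insert a F)}
    let T₂ : Set ℕ := {a ∈ T | ∀ F : Finset ℕ, ↑F ⊆ T ∩ Set.Ioi a → F.card = k → ¬P (insert a F)}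
    have hunion : T ⊆ T₁ ∪ T₂ := fun a ha =>
      (hom a ha).elim (fun h => .inl ⟨ha, h⟩) (fun h => .inr ⟨ha, h⟩)
    rcases Set.infinite_union.1 (hT.mono hunion) with h | h
    · refine ⟨T₁, fun a ha => hTS ha.1, h, .inl fun F hF hcard => ?_⟩
      obtain ⟨a, ha, G, hG, hGc, rfl⟩ := split F T₁ (fun a ha => ha.1) hF hcard
      exact ha.2 G hG hGc
    · refine ⟨T₂, fun a ha => hTS ha.1, h, .inr fun F hF hcard => ?_⟩
      obtain ⟨a, ha, G, hG, hGc, rfl⟩ := split F T₂ (fun a ha => ha.1) hF hcard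
      exact ha.2 G hG hGc

/-- A splitting of a finite set into a lower and an upper part is determined by the sizes. -/
theorem Finset.eq_of_union_eq_of_forall_lt {A B A' B' : Finset ℕ} (hcard : A.card = A'.card)
    (h : A ∪ B = A' ∪ B') (hAB : ∀ a ∈ A, ∀ b ∈ B, a < b) (hAB' : ∀ a ∈ A', ∀ b ∈ B', a < b) :
    A = A' := by
  refine (Finset.eq_of_subset_of_card_le (fun a ha => ?_) hcard.le).symm
  by_contra haA
  have haB : a ∈ B := by
    have : a ∈ A ∪ B := h ▸ Finset.mem_union_left _ ha
    exact (Finset.mem_union.1 this).resolve_left haA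
  -- An element of `A` is below `a ∈ B`, while an element of `B'` is above `a ∈ A'`. So `A` is a
  -- proper subset of `A'`, against the equal sizes.
  have hsub : A ⊆ A' := fun c hc => by
    have : c ∈ A' ∪ B' := h ▸ Finset.mem_union_left _ hc
    refine (Finset.mem_union.1 this).resolve_right fun hcB => ?_
    exact lt_asymm (hAB c hc a haB) (hAB' a ha c hcB)
  have hlt := Finset.card_lt_card (Finset.ssubset_iff_of_subset hsub |>.2 ⟨a, ha, haA⟩)
  omega

/-! ### Block averages and convergence of arithmetic means -/

section Cesaro

variable {E : Type*} [NormedAddCommGroup E]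

/-- For some block length `k > 0`, the averages of `x` over any two successive `k`-element subsets
of `T` differ by at most `ε`. -/
def HasCloseBlocks (x : ℕ → E) (ε : ℝ) (T : Set ℕ) : Prop :=
  ∃ k > 0, ∀ A B : Finset ℕ, ↑A ⊆ T → ↑B ⊆ T → A.card = k → B.card = k →
    (∀ a ∈ A, ∀ b ∈ B, a < b) → ‖∑ i ∈ A, x i - ∑ i ∈ B, x i‖ ≤ k * ε

theorem HasCloseBlocks.mono {x : ℕ → E} {ε : ℝ} {S T : Set ℕ} (hTS : T ⊆ S)
    (h : HasCloseBlocks x ε S) : HasCloseBlocks x ε T := by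
  obtain ⟨k, hk, h⟩ := h
  exact ⟨k, hk, fun A B hA hB => h A B (hA.trans hTS) (hB.trans hTS)⟩

variable {𝕜 : Type*} [RCLike 𝕜] [NormedSpace 𝕜 E]

/-- The sum of the first ck terms divided by k tends to cz, so both block averages tend to z. The
blocks start at 2k so that, for k > 0, all their indices exceed k. -/
theorem CesaroConverges.tendsto_block_sub {y : ℕ → E} (hy : CesaroConverges 𝕜 y) :
    Tendsto (fun k : ℕ => (k : 𝕜)⁻¹ • (∑ i ∈ Finset.Ico (2 * k) (3 * k), y i -
      ∑ i ∈ Finset.Ico (3 * k) (4 * k), y i)) atTop (𝓝 0) := by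
  obtain ⟨z, hz⟩ := hy
  have hmul : ∀ c : ℕ, 0 < c → Tendsto (fun k : ℕ => (k : 𝕜)⁻¹ • ∑ i ∈ Finset.range (c * k), y i)
      atTop (𝓝 ((c : 𝕜) • z)) := by
    intro c hc
    have h := (hz.comp (tendsto_id.const_mul_atTop' hc)).const_smul (c : 𝕜)
    refine h.congr fun k => ?_
    have hc' : (c : 𝕜) ≠ 0 := by exact_mod_cast hc.ne'
    simp only [Function.comp_apply, id, smul_smul, Nat.cast_mul, mul_inv]
    rw [mul_inv_cancel_left₀ hc']
  have h := (((hmul 3 (by norm_num)).sub (hmul 2 (by norm_num))).sub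
    ((hmul 4 (by norm_num)).sub (hmul 3 (by norm_num))))
  have h0 : ((3 : ℕ) : 𝕜) • z - ((2 : ℕ) : 𝕜) • z - (((4 : ℕ) : 𝕜) • z - ((3 : ℕ) : 𝕜) • z)
      = 0 := by
    push_cast
    module
  rw [h0] at h
  refine h.congr fun k => ?_
  rw [Finset.sum_Ico_eq_sub _ (by omega), Finset.sum_Ico_eq_sub _ (by omega), smul_sub, smul_sub,
    smul_sub]

theorem exists_infinite_hasCloseBlocks {x : ℕ → E}
    (hx : ∀ φ : ℕ → ℕ, StrictMono φ → ∃ ψ : ℕ → ℕ, StrictMono ψ ∧ CesaroConverges 𝕜 (x ∘ φ ∘ ψ))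
    {ε : ℝ} (hε : 0 < ε) {S : Set ℕ} (hS : S.Infinite) :
    ∃ T ⊆ S, T.Infinite ∧ HasCloseBlocks x ε T := by
  let P : ℕ → Finset ℕ → Prop := fun k F => ∃ A B : Finset ℕ, A.card = k ∧ B.card = k ∧
    (∀ a ∈ A, ∀ b ∈ B, a < b) ∧ A ∪ B = F ∧ ‖∑ i ∈ A, x i - ∑ i ∈ B, x i‖ ≤ k * ε
  -- The right k is known only once a subsequence of `T` is chosen, so all k are made homogeneous
  -- beforehand.
  obtain ⟨T, hTS, hT, hom⟩ := exists_infinite_diagonal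
    (Q := fun k T => IsHomogeneous (P k) (k + k) T) (fun n S T hTS h => h.mono hTS)
    (fun k S hS => exists_infinite_isHomogeneous (k + k) (P k) hS) hS
  have hφ : StrictMono (Nat.nth (· ∈ T)) := Nat.nth_strictMono hT
  obtain ⟨ψ, hψ, hconv⟩ := hx _ hφ
  have hχ := hφ.comp hψ
  set χ := Nat.nth (· ∈ T) ∘ ψ
  have hχT : ∀ n, χ n ∈ T := fun n => Nat.nth_mem_of_infinite hT _
  obtain ⟨k, hk, hkpos⟩ := ((hconv.tendsto_block_sub.norm.eventually_lt_const
    (by simpa using hε)).and (eventually_gt_atTop 0)).exists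
  let A : Finset ℕ := (Finset.Ico (2 * k) (3 * k)).map ⟨χ, hχ.injective⟩
  let B : Finset ℕ := (Finset.Ico (3 * k) (4 * k)).map ⟨χ, hχ.injective⟩
  have hAcard : A.card = k := by simp [A]; omega
  have hBcard : B.card = k := by simp [B]; omega
  have hlt : ∀ a ∈ A, ∀ b ∈ B, a < b := by
    intro a ha b hb
    obtain ⟨i, hi, rfl⟩ := Finset.mem_map.1 ha
    obtain ⟨j, hj, rfl⟩ := Finset.mem_map.1 hb
    rw [Finset.mem_Ico] at hi hj
    exact hχ (by omega)
  have hclose : ‖∑ i ∈ A, x i - ∑ i ∈ B, x i‖ ≤ k * ε := by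
    rw [norm_smul, norm_inv, RCLike.norm_natCast, inv_mul_lt_iff₀ (by exact_mod_cast hkpos)] at hk
    simpa [A, B] using hk.le
  have hmem : (↑(A ∪ B) : Set ℕ) ⊆ T ∩ Set.Ioi (χ k) := by
    intro a ha
    rw [Finset.mem_coe, Finset.mem_union] at ha
    rcases ha with ha | ha <;> obtain ⟨i, hi, rfl⟩ := Finset.mem_map.1 ha <;>
      rw [Finset.mem_Ico] at hi <;> exact ⟨hχT i, hχ (by omega)⟩
  have disj : ∀ {A B : Finset ℕ}, (∀ a ∈ A, ∀ b ∈ B, a < b) → Disjoint A B := fun h =>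
    Finset.disjoint_left.2 fun a ha hb => lt_irrefl _ (h a ha a hb)
  refine ⟨T ∩ Set.Ioi (χ k), Set.inter_subset_left.trans hTS, ?_, k, hkpos, ?_⟩
  · refine (hT.sdiff (Set.finite_Iic (χ k))).mono fun x hx => ⟨hx.1, ?_⟩
    simpa using hx.2
  intro A' B' hA' hB' hA'card hB'card hlt'
  -- In the first case the halves witnessing `P k` must be `A'` and `B'`; the second case is refuted
  -- by `A ∪ B`.
  rcases hom (χ k) (hχT k) k (hχ.id_le k) with h | h
  · obtain ⟨A'', B'', hA'', hB'', hlt'', hunion, hle⟩ := h (A' ∪ B')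
      (by rw [Finset.coe_union]; exact Set.union_subset hA' hB')
      (by rw [Finset.card_union_of_disjoint (disj hlt'), hA'card, hB'card])
    have hA : A'' = A' :=
      Finset.eq_of_union_eq_of_forall_lt (hA''.trans hA'card.symm) hunion hlt'' hlt'
    subst hA
    have hB : B'' = B' := by
      rw [← Finset.union_sdiff_cancel_left (disj hlt''), hunion,
        Finset.union_sdiff_cancel_left (disj hlt')]
    subst hB
    exact hle
  · exact absurd ⟨A, B, hAcard, hBcard, hlt, rfl, hclose⟩ (h (A ∪ B) hmem
      (by rw [Finset.card_union_of_disjoint (disj hlt), hAcard, hBcard]))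

/-- If `‖d (n + k) - d n‖ ≤ k * ε` for all large `n`, then `‖d n‖` grows at most like `n * ε`. -/
theorem exists_norm_le_add_mul {d : ℕ → E} {k n₀ : ℕ} {ε : ℝ} (hk : 0 < k)
    (hε : 0 ≤ ε) (hd : ∀ n ≥ n₀, ‖d (n + k) - d n‖ ≤ k * ε) : ∃ M, ∀ n, ‖d n‖ ≤ M + n * ε := by
  refine ⟨∑ i ∈ Finset.range (n₀ + k), ‖d i‖, fun n => ?_⟩
  induction n using Nat.strong_induction_on with
  | _ n ih =>
    rcases lt_or_ge n (n₀ + k) with hn | hn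
    · have := Finset.single_le_sum (f := fun i => ‖d i‖) (fun i _ => norm_nonneg _)
        (Finset.mem_range.2 hn)
      have h2 : 0 ≤ n * ε := by positivity
      linarith
    · obtain ⟨l, rfl⟩ : ∃ l, n = l + k := ⟨n - k, by omega⟩
      have h1 := hd l (by omega)
      have h2 := ih l (by omega)
      have h3 : ‖d (l + k)‖ ≤ ‖d l‖ + ‖d (l + k) - d l‖ := by
        simpa using norm_add_le (d l) (d (l + k) - d l)
      push_cast
      linarith

/-- Let c be the average of one block. All later block averages are near c, so the partial sums
minus nc grow at a small linear rate, and the means end up near c. -/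
theorem cesaroConverges_of_close_blocks [CompleteSpace E] {y : ℕ → E}
    (hy : ∀ ε > 0, ∃ k > 0, ∃ n₀ : ℕ, ∀ a ≥ n₀, ∀ b ≥ a + k,
      ‖∑ i ∈ Finset.Ico a (a + k), y i - ∑ i ∈ Finset.Ico b (b + k), y i‖ ≤ k * ε) :
    CesaroConverges 𝕜 y := by
  refine cauchySeq_tendsto_of_complete (Metric.cauchySeq_iff'.2 fun ε hε => ?_)
  -- Two comparisons at ε/8 give the rate ε/4; the room up to ε/2 absorbs M/n.
  obtain ⟨k, hk, n₀, hblocks⟩ := hy (ε / 8) (by positivity)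
  have hk0 : (k : 𝕜) ≠ 0 := by exact_mod_cast hk.ne'
  set c : E := (k : 𝕜)⁻¹ • ∑ i ∈ Finset.Ico n₀ (n₀ + k), y i
  have hd : ∀ n ≥ n₀, ‖(∑ i ∈ Finset.range (n + k), y i - ((n + k : ℕ) : 𝕜) • c) -
      (∑ i ∈ Finset.range n, y i - (n : 𝕜) • c)‖ ≤ k * (ε / 4) := by
    intro n hn
    -- The blocks at `n` and `n₀` may overlap, so both are compared with a block beyond them.
    have h1 := hblocks n hn (n + n₀ + k) (by omega)
    have h2 := hblocks n₀ le_rfl (n + n₀ + k) (by omega)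
    have h3 : (∑ i ∈ Finset.range (n + k), y i - ((n + k : ℕ) : 𝕜) • c) -
        (∑ i ∈ Finset.range n, y i - (n : 𝕜) • c) =
        ∑ i ∈ Finset.Ico n (n + k), y i - ∑ i ∈ Finset.Ico n₀ (n₀ + k), y i := by
      have hkc : (k : 𝕜) • c = ∑ i ∈ Finset.Ico n₀ (n₀ + k), y i := smul_inv_smul₀ hk0 _
      rw [← hkc, Finset.sum_Ico_eq_sub _ (by omega)]
      push_cast
      rw [add_smul]
      abel
    rw [h3]
    have h4 := norm_sub_le_norm_sub_add_norm_sub (∑ i ∈ Finset.Ico n (n + k), y i)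
      (∑ i ∈ Finset.Ico (n + n₀ + k) (n + n₀ + k + k), y i) (∑ i ∈ Finset.Ico n₀ (n₀ + k), y i)
    rw [norm_sub_rev (∑ i ∈ Finset.Ico (n + n₀ + k) (n + n₀ + k + k), y i)] at h4
    linarith
  obtain ⟨M, hM⟩ := exists_norm_le_add_mul (d := fun n => ∑ i ∈ Finset.range n, y i - (n : 𝕜) • c)
    hk (by positivity) hd
  have hmean : ∀ᶠ n : ℕ in atTop, dist ((n : 𝕜)⁻¹ • ∑ i ∈ Finset.range n, y i) c < ε / 2 := by
    have hlim : Tendsto (fun n : ℕ => M / (n : ℝ) + ε / 4) atTop (𝓝 (0 + ε / 4)) :=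
      (tendsto_const_div_atTop_nhds_zero_nat M).add_const _
    filter_upwards [hlim.eventually_lt_const (by linarith : 0 + ε / 4 < ε / 2),
      eventually_gt_atTop 0] with n hn hpos
    have hn0 : (n : 𝕜) ≠ 0 := by exact_mod_cast hpos.ne'
    have hnpos : (0 : ℝ) < n := by exact_mod_cast hpos
    have h1 : (n : 𝕜)⁻¹ • ∑ i ∈ Finset.range n, y i - c =
        (n : 𝕜)⁻¹ • (∑ i ∈ Finset.range n, y i - (n : 𝕜) • c) := by
      rw [smul_sub, inv_smul_smul₀ hn0]
    rw [dist_eq_norm, h1, norm_smul, norm_inv, RCLike.norm_natCast]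
    refine lt_of_le_of_lt ?_ hn
    rw [inv_mul_le_iff₀ hnpos, mul_add, mul_div_cancel₀ _ hnpos.ne']
    exact hM n
  obtain ⟨n₁, hn₁⟩ := eventually_atTop.1 hmean
  refine ⟨n₁, fun n hn => ?_⟩
  have h1 := hn₁ n hn
  have h2 := hn₁ n₁ le_rfl
  have h3 := dist_triangle_right ((n : 𝕜)⁻¹ • ∑ i ∈ Finset.range n, y i)
    ((n₁ : 𝕜)⁻¹ • ∑ i ∈ Finset.range n₁, y i) c
  linarith

/-- If every subsequence of `x` has a further subsequence with convergent arithmetic means, then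
`x` has a subsequence all of whose subsequences have convergent arithmetic means. -/
theorem exists_subseq_forall_subseq_cesaroConverges [CompleteSpace E] {x : ℕ → E}
    (hx : ∀ φ : ℕ → ℕ, StrictMono φ →
      ∃ ψ : ℕ → ℕ, StrictMono ψ ∧ CesaroConverges 𝕜 (x ∘ φ ∘ ψ)) :
    ∃ φ : ℕ → ℕ, StrictMono φ ∧
      ∀ ψ : ℕ → ℕ, StrictMono ψ → CesaroConverges 𝕜 (x ∘ φ ∘ ψ) := by
  obtain ⟨T, -, hT, hclose⟩ := exists_infinite_diagonal
    (Q := fun p T => HasCloseBlocks x (1 / ((p : ℝ) + 1)) T) (fun n S T hTS h => h.mono hTS)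
    (fun p S hS => exists_infinite_hasCloseBlocks hx (by positivity) hS) Set.infinite_univ
  refine ⟨Nat.nth (· ∈ T), Nat.nth_strictMono hT, fun ψ hψ => ?_⟩
  have hφ : StrictMono (Nat.nth (· ∈ T)) := Nat.nth_strictMono hT
  have hχ := hφ.comp hψ
  set χ := Nat.nth (· ∈ T) ∘ ψ
  have hχT : ∀ n, χ n ∈ T := fun n => Nat.nth_mem_of_infinite hT _
  refine cesaroConverges_of_close_blocks fun ε hε => ?_
  obtain ⟨p, hp⟩ := exists_nat_one_div_lt hε
  obtain ⟨k, hk, h⟩ := hclose (χ p) (hχT p) p (hχ.id_le p)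
  -- Indices from `p + 1` on are mapped by `χ` strictly beyond `χ p`, where the close-block property
  -- holds.
  refine ⟨k, hk, p + 1, fun a ha b hb => ?_⟩
  have hsub : ∀ c ≥ p + 1,
      (↑((Finset.Ico c (c + k)).map ⟨χ, hχ.injective⟩) : Set ℕ) ⊆ T ∩ Set.Ioi (χ p) := by
    intro c hc i hi
    obtain ⟨j, hj, rfl⟩ := Finset.mem_map.1 (Finset.mem_coe.1 hi)
    rw [Finset.mem_Ico] at hj
    exact ⟨hχT j, hχ (by omega)⟩
  have h' := h _ _ (hsub a ha) (hsub b (by omega)) (by simp) (by simp) (by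
    intro i hi j hj
    obtain ⟨i', hi', rfl⟩ := Finset.mem_map.1 hi
    obtain ⟨j', hj', rfl⟩ := Finset.mem_map.1 hj
    rw [Finset.mem_Ico] at hi' hj'
    exact hχ (by omega))
  rw [Finset.sum_map, Finset.sum_map] at h'
  exact h'.trans (by gcongr)

end Cesaro

/-- A common subsequence along which the arithmetic means of finitely many sequences converge. -/
theorem exists_common_subseq_cesaroConverges {𝕜 ι : Type*} [RCLike 𝕜] [Finite ι] {B : ι → Type*}
    [∀ j, NormedAddCommGroup (B j)] [∀ j, NormedSpace 𝕜 (B j)] [∀ j, CompleteSpace (B j)]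
    {x : ∀ j, ℕ → B j}
    (hx : ∀ j, ∀ φ : ℕ → ℕ, StrictMono φ →
      ∃ ψ : ℕ → ℕ, StrictMono ψ ∧ CesaroConverges 𝕜 (x j ∘ φ ∘ ψ)) :
    ∃ φ : ℕ → ℕ, StrictMono φ ∧ ∀ j, CesaroConverges 𝕜 (x j ∘ φ) := by
  classical
  have := Fintype.ofFinite ι
  have key : ∀ s : Finset ι, ∃ φ : ℕ → ℕ, StrictMono φ ∧
      ∀ j ∈ s, ∀ ψ : ℕ → ℕ, StrictMono ψ → CesaroConverges 𝕜 (x j ∘ φ ∘ ψ) := by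
    intro s
    induction s using Finset.induction_on with
    | empty => exact ⟨id, strictMono_id, by simp⟩
    | insert j s hj ih =>
      obtain ⟨φ, hφ, h⟩ := ih
      -- The conclusion for all further subsequences is what lets the coordinates in `s` survive the
      -- refinement by `θ`.
      obtain ⟨θ, hθ, h'⟩ := exists_subseq_forall_subseq_cesaroConverges (x := x j ∘ φ)
        fun ψ hψ => by
          obtain ⟨χ, hχ, hc⟩ := hx j (φ ∘ ψ) (hφ.comp hψ)
          exact ⟨χ, hχ, hc⟩
      refine ⟨φ ∘ θ, hφ.comp hθ, fun i hi ψ hψ => ?_⟩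
      rcases Finset.mem_insert.1 hi with rfl | hi
      · exact h' ψ hψ
      · exact h i hi (θ ∘ ψ) (hθ.comp hψ)
  obtain ⟨φ, hφ, h⟩ := key Finset.univ
  exact ⟨φ, hφ, fun j => h j (Finset.mem_univ j) id strictMono_id⟩

/-! ### Topology of the product space and the main theorem -/

namespace ProductSpace

variable {m : ℕ} {B : Fin m → Type*} [∀ j, NormedAddCommGroup (B j)]
  {N : (Fin m → ℝ≥0) → ℝ≥0} (hN : IsProductNormFunction B N)

theorem tendsto_zero_iff (x : ℕ → ProductSpace hN) :
    Tendsto x atTop (𝓝 0) ↔ ∀ j, Tendsto (fun n => x n j) atTop (𝓝 0) := by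
  have h := hN.tendsto_zero_iff x
  rw [tendsto_zero_iff_norm_tendsto_zero, forall_congr' fun j =>
    tendsto_zero_iff_norm_tendsto_zero (f := fun n => x n j), ← h, ← NNReal.tendsto_coe]
  rfl

variable (𝕜 : Type*) [RCLike 𝕜] [∀ j, NormedSpace 𝕜 (B j)]

/-- The norm of the product space induces the product topology. -/
noncomputable def equivPi : ProductSpace hN ≃L[𝕜] (∀ j, B j) where
  toFun x := x
  invFun x := x
  map_add' _ _ := rfl
  map_smul' _ _ := rfl
  left_inv _ := rfl
  right_inv _ := rfl
  continuous_toFun := by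
    refine continuous_pi fun j => continuous_iff_seqContinuous.2 fun x l hx => ?_
    have h := (tendsto_zero_iff hN fun n => x n - l).1 (tendsto_sub_nhds_zero_iff.2 hx) j
    exact tendsto_sub_nhds_zero_iff.1 h
  continuous_invFun := by
    refine continuous_iff_seqContinuous.2 fun x l hx => ?_
    refine tendsto_sub_nhds_zero_iff.1 ((tendsto_zero_iff hN _).2 fun j => ?_)
    exact tendsto_sub_nhds_zero_iff.2 (tendsto_pi_nhds.1 hx j)

/-- The coordinate projection as a continuous linear map. -/
noncomputable def proj (j : Fin m) : ProductSpace hN →L[𝕜] B j :=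
  (ContinuousLinearMap.proj j).comp (equivPi hN 𝕜 : ProductSpace hN →L[𝕜] (∀ j, B j))

theorem completeSpace (𝕂 : Type*) [RCLike 𝕂] [∀ j, NormedSpace 𝕂 (B j)]
    [∀ j, CompleteSpace (B j)] : CompleteSpace (ProductSpace hN) :=
  (completeSpace_congr (e := (equivPi hN 𝕂).toEquiv)
    (equivPi hN 𝕂).isUniformEmbedding).2 inferInstance

variable {𝕜} in
theorem cesaroConverges {y : ℕ → ProductSpace hN}
    (hy : ∀ j, CesaroConverges 𝕜 fun n => proj hN 𝕜 j (y n)) : CesaroConverges 𝕜 y := by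
  choose z hz using hy
  refine ⟨(equivPi hN 𝕜).symm z, ?_⟩
  have h := ((equivPi hN 𝕜).symm.continuous.tendsto z).comp (tendsto_pi_nhds.2 hz)
  refine h.congr fun n => ?_
  rw [Function.comp_apply, ContinuousLinearEquiv.symm_apply_eq]
  funext j
  have hmap := map_smul (proj hN 𝕜 j) (n : 𝕜)⁻¹ (∑ i ∈ Finset.range n, y i)
  rw [map_sum] at hmap
  exact hmap.symm

end ProductSpace

theorem theorem1 {𝕜 : Type*} [RCLike 𝕜] {m : ℕ} {B : Fin m → Type*}
    [∀ j, NormedAddCommGroup (B j)] [∀ j, NormedSpace 𝕜 (B j)] [∀ j, CompleteSpace (B j)]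
    {N : (Fin m → ℝ≥0) → ℝ≥0} (hN : IsProductNormFunction B N) :
    CompleteSpace (ProductSpace hN) ∧
      ((∀ j, BanachSaksProperty 𝕜 (B j)) → BanachSaksProperty 𝕜 (ProductSpace hN)) ∧
      ((∀ j, WeakBanachSaksProperty 𝕜 (B j)) → WeakBanachSaksProperty 𝕜 (ProductSpace hN)) := by
  refine ⟨ProductSpace.completeSpace hN 𝕜, fun h x hx => ?_, fun h x l hx => ?_⟩
  · obtain ⟨φ, hφ, hc⟩ := exists_common_subseq_cesaroConverges (𝕜 := 𝕜)
      (x := fun j n => ProductSpace.proj hN 𝕜 j (x n)) fun j φ _ => by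
        have hb := (ProductSpace.proj hN 𝕜 j).lipschitz.isBounded_image hx
        exact h j (fun n => ProductSpace.proj hN 𝕜 j (x (φ n))) (hb.subset (by
          rintro _ ⟨n, rfl⟩
          exact ⟨x (φ n), ⟨φ n, rfl⟩, rfl⟩))
    exact ⟨φ, hφ, ProductSpace.cesaroConverges hN hc⟩
  · obtain ⟨φ, hφ, hc⟩ := exists_common_subseq_cesaroConverges (𝕜 := 𝕜)
      (x := fun j n => ProductSpace.proj hN 𝕜 j (x n)) fun j φ hφ => by
        -- The projections are weak-to-weak continuous, so every subsequence converges weakly in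
        -- each coordinate.
        have hw := ((WeakSpace.map (ProductSpace.proj hN 𝕜 j)).continuous.tendsto _).comp
          (hx.comp hφ.tendsto_atTop)
        exact h j (fun n => ProductSpace.proj hN 𝕜 j (x (φ n))) (ProductSpace.proj hN 𝕜 j l) hw
    exact ⟨φ, hφ, ProductSpace.cesaroConverges hN hc⟩
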